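/- Let $K$ be a non-archimedean local field with normalised discrete valuation $w:K^\times\to\mathbb{Z}$. Fix a Haar measure $dx$ on the additive group of $K$, a non-trivial continuous additive character $\psi_K:K\to S^1$, and a prime element $\pi$ of $K$ (that is, $w(\pi)=1$). Let $\mathcal{S}(K)$ be the Schwartz-Bruhat space of $K$, i.e. the complex vector space of locally constant, compactly supported functions $K\to\mathbb{C}$. Define $\nabla:K\to K$ by $\nabla(0)=0$ and $\nabla(x)=\pi^{w(x)}x$ for $x\neq 0$. For $g:K\to\mathbb{C}$ define $Wg:K\to\mathbb{C}$ by $Wg(0)=g(0)$ and, for $x\ne 0$, \[Wg(x)=\begin{cases} g(\pi^{-w(x)/2}x) & \text{if } w(x) \text{ is even},\\ g(\pi^{(-w(x)-1)/2}x) & \text{if } w(x)\text{ is odd}.\end{cases}\] When $Wg$ is integrable, the $*$-transform of $g$ is $g^*=\widehat{Wg}\circ\nabla$, where $\hat h(y)=\int_K h(x)\psi_K(xy)\,dx$. Then for every $g\in\mathcal{S}(K)$ the function $Wg$ is integrable and $g^*\in\mathcal{S}(K)$, and the map $g\mapsto g^*$ is a linear automorphism (a bijective $\mathbb{C}$-linear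 map) of $\mathcal{S}(K)$. -/

import Mathlib

open MeasureTheory

noncomputable section

namespace LocalStar

/-- The normalised discrete valuation `w` of a non-archimedean local field `K`: the canonical
valuation followed by the unique order isomorphism of its value group with `ℤ`, written additively,
so that elements of large `w` are close to `0`. Junk value `w 0 = 0`. -/
def ord (K : Type*) [Field K] [ValuativeRel K] [TopologicalSpace K]
    [IsNonarchimedeanLocalField K] (x : K) : ℤ :=
  -WithZero.log
    (IsNonarchimedeanLocalField.valueGroupWithZeroIsoInt K (ValuativeRel.valuation K x))

/-- The Schwartz-Bruhat space of `K`: the complex vector space of locally constant functions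
`K → ℂ` of compact support. -/
def SchwartzBruhat (K : Type*) [TopologicalSpace K] : Submodule ℂ (K → ℂ) where
  carrier := {f | IsLocallyConstant f ∧ HasCompactSupport f}
  add_mem' hf hg := ⟨hf.1.add hg.1, hf.2.add hg.2⟩
  zero_mem' := ⟨IsLocallyConstant.const 0, HasCompactSupport.zero⟩
  smul_mem' c _ hf := ⟨hf.1.comp (fun z => c • z), hf.2.comp_left (smul_zero c)⟩

/-- The Fourier transform `y ↦ ∫ g(x) ψ(xy) dx` with respect to the additive character `ψ` and the
measure `μ`. -/
def fourier {K : Type*} [Field K] [MeasurableSpace K] (ψ : AddChar K Circle) (μ : Measure K)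
    (g : K → ℂ) (y : K) : ℂ :=
  ∫ x, g x * (ψ (x * y) : ℂ) ∂μ

section

variable {K : Type*} [Field K] [ValuativeRel K] [TopologicalSpace K] [IsNonarchimedeanLocalField K]

/-- `∇ x = π ^ w(x) * x`; in particular `∇ 0 = 0`. -/
def nabla (π : K) (x : K) : K := π ^ ord K x * x

open Classical in
/-- The function `W g`: `W g (0) = g 0`, and for `x ≠ 0`, `W g (x) = g (π ^ (-w(x)/2) x)` when
`w(x)` is even, `W g (x) = g (π ^ ((-w(x)-1)/2) x)` when `w(x)` is odd (both divisions in `ℤ` are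
exact). -/
def W (π : K) (g : K → ℂ) (x : K) : ℂ :=
  if x = 0 then g 0
  else if Even (ord K x) then g (π ^ ((-ord K x) / 2) * x)
  else g (π ^ ((-ord K x - 1) / 2) * x)

/-- The `*`-transform of `g` with respect to `π`, `ψ`, `μ`: the Fourier transform of `W g`, composed
with `∇`. It is meaningful when `W g` is integrable. -/
def starTransform [MeasurableSpace K] (π : K) (ψ : AddChar K Circle) (μ : Measure K)
    (g : K → ℂ) (x : K) : ℂ :=
  fourier ψ μ (W π g) (nabla π x)

end

end LocalStar

end

open MeasureTheory
noncomputable section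
namespace LocalStar

/-! ### The valuation and the fractional ideals it defines. -/

section Ord

variable {K : Type*} [Field K] [ValuativeRel K] [TopologicalSpace K] [IsNonarchimedeanLocalField K]

open IsNonarchimedeanLocalField ValuativeRel WithZero

/-! Write `T` for the `*`-transform and `d` for the conductor of `ψ`. `W` and the map `f ↦ f ∘ nabla
π` preserve the Schwartz-Bruhat space (`W_mem`, `comp_nabla_mem`), as does the Fourier transform, so
`T` is an endomorphism. Bijectivity comes from computing `T²` along the filtration of the space by
invariance under the unit groups `U^c` of units congruent to `1` at level `c`; every Schwartz-Bruhat
function is invariant under some `U^c` (`exists_unitInvariant`).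

On radial functions `T²` is a nonzero scalar: these are spanned by indicators of fractional ideals,
which `T` permutes up to volumes (`starMap_starMap_of_radial`).

For `c ≥ 1`, take `f` invariant under `U^c`, `u` in `U^(c-1)`, and `φ = f - f(u ·)`. As for
characters of exact conductor `c`, whose Gauss sums live on one shell, the Fourier transform carries
the part of `W φ` on the shell of valuation `n` to the shell `d - c - n`
(`fourier_shells_sub_unit_mul`). Since `nabla` sees only even valuations, `T φ` retains exactly half
the shells of `W φ`; but either parity class of shells of `W φ` determines `φ`. Fourier inversion
then gives `T² φ = C φ(-·)` with `C ≠ 0` depending only on the parity of `d - c`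
(`exists_starMap_starMap_sub_dilate`).

As `T²` commutes with unit dilations, `T² f - C f(-·)` is invariant under `U^(c-1)`. Induction on
`c` yields both injectivity and surjectivity. -/

theorem valueGroup_ne_zero {x : K} (hx : x ≠ 0) :
    valueGroupWithZeroIsoInt K (valuation K x) ≠ 0 := by
  simp [hx]

@[simp] theorem ord_zero : ord K (0 : K) = 0 := by simp [ord]

@[simp] theorem ord_one : ord K (1 : K) = 0 := by simp [ord]

theorem ord_mul {x y : K} (hx : x ≠ 0) (hy : y ≠ 0) : ord K (x * y) = ord K x + ord K y := by
  simp only [ord, map_mul]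
  rw [log_mul (valueGroup_ne_zero hx) (valueGroup_ne_zero hy)]
  ring

theorem ord_inv (x : K) : ord K x⁻¹ = -ord K x := by
  simp [ord]

theorem ord_zpow (x : K) (n : ℤ) : ord K (x ^ n) = n * ord K x := by
  simp [ord]

@[simp] theorem ord_neg (x : K) : ord K (-x) = ord K x := by
  simp [ord]

theorem le_ord_iff {x y : K} (hx : x ≠ 0) (hy : y ≠ 0) :
    ord K x ≤ ord K y ↔ valuation K y ≤ valuation K x := by
  simp only [ord, neg_le_neg_iff]
  rw [log_le_log (valueGroup_ne_zero hy) (valueGroup_ne_zero hx)]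
  simp

theorem min_ord_le_ord_add {x y : K} (hx : x ≠ 0) (hy : y ≠ 0) (h : x + y ≠ 0) :
    min (ord K x) (ord K y) ≤ ord K (x + y) := by
  rcases le_total (valuation K x) (valuation K y) with hv | hv
  · refine (min_le_right _ _).trans ((le_ord_iff hy h).2 ?_)
    exact (Valuation.map_add_le _ hv le_rfl)
  · refine (min_le_left _ _).trans ((le_ord_iff hx h).2 ?_)
    exact (Valuation.map_add_le _ le_rfl hv)

variable (K) in
/-- The fractional ideal of elements of valuation at least `m`. -/
def fracIdeal (m : ℤ) : AddSubgroup K where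
  carrier := {x | x = 0 ∨ m ≤ ord K x}
  zero_mem' := Or.inl rfl
  add_mem' := by
    rintro x y (rfl | hx) (rfl | hy)
    · simp
    · simp [hy]
    · simp [hx]
    · by_cases hx0 : x = 0
      · simp [hx0, hy]
      by_cases hy0 : y = 0
      · simp [hy0, hx]
      by_cases h : x + y = 0
      · exact Or.inl h
      · exact Or.inr ((le_min hx hy).trans (min_ord_le_ord_add hx0 hy0 h))
  neg_mem' := by
    rintro x (rfl | hx)
    · simp
    · exact Or.inr (by simpa using hx)

theorem mem_fracIdeal {m : ℤ} {x : K} : x ∈ fracIdeal K m ↔ x = 0 ∨ m ≤ ord K x := Iff.rfl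

theorem notMem_fracIdeal {m : ℤ} {x : K} : x ∉ fracIdeal K m ↔ x ≠ 0 ∧ ord K x < m := by
  rw [mem_fracIdeal]; push Not; rfl

theorem mem_fracIdeal_of_ne_zero {m : ℤ} {x : K} (hx : x ≠ 0) :
    x ∈ fracIdeal K m ↔ m ≤ ord K x := by
  simp [mem_fracIdeal, hx]

theorem fracIdeal_anti {m n : ℤ} (h : m ≤ n) {x : K} (hx : x ∈ fracIdeal K n) :
    x ∈ fracIdeal K m :=
  hx.imp_right h.trans

theorem mul_mem_fracIdeal {m n : ℤ} {x y : K} (hx : x ∈ fracIdeal K m) (hy : y ∈ fracIdeal K n) :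
    x * y ∈ fracIdeal K (m + n) := by
  by_cases hx0 : x = 0
  · simp [hx0, zero_mem]
  by_cases hy0 : y = 0
  · simp [hy0, zero_mem]
  rw [mem_fracIdeal_of_ne_zero hx0] at hx
  rw [mem_fracIdeal_of_ne_zero hy0] at hy
  rw [mem_fracIdeal_of_ne_zero (mul_ne_zero hx0 hy0), ord_mul hx0 hy0]
  omega

theorem mul_mem_fracIdeal_iff {a : K} (ha : a ≠ 0) {m : ℤ} {x : K} :
    a * x ∈ fracIdeal K m ↔ x ∈ fracIdeal K (m - ord K a) := by
  by_cases hx : x = 0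
  · simp [hx, zero_mem]
  rw [mem_fracIdeal_of_ne_zero hx, mem_fracIdeal_of_ne_zero (mul_ne_zero ha hx), ord_mul ha hx]
  omega

theorem self_mem_fracIdeal (x : K) : x ∈ fracIdeal K (ord K x) := Or.inr le_rfl

/-- Elements outside a fractional ideal keep their valuation when translated by it. -/
theorem ord_add_of_notMem {m : ℤ} {x t : K} (hx : x ∉ fracIdeal K m) (ht : t ∈ fracIdeal K m) :
    x + t ∉ fracIdeal K m ∧ ord K (x + t) = ord K x := by
  have h1 : x + t ∉ fracIdeal K m := fun h ↦ hx (by simpa using sub_mem h ht)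
  refine ⟨h1, ?_⟩
  by_cases ht0 : t = 0
  · simp [ht0]
  obtain ⟨hx0, hxm⟩ := notMem_fracIdeal.1 hx
  obtain ⟨hy0, hym⟩ := notMem_fracIdeal.1 h1
  rw [mem_fracIdeal_of_ne_zero ht0] at ht
  have h2 := min_ord_le_ord_add hx0 ht0 hy0
  have h3 := min_ord_le_ord_add hy0 (neg_ne_zero.2 ht0) (by simpa using hx0)
  simp only [add_neg_cancel_right, ord_neg] at h3
  omega

variable (K) in
theorem coe_fracIdeal_eq_closedBall (m : ℤ) : (fracIdeal K m : Set K) =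
    {x | valuation K x ≤ (valueGroupWithZeroIsoInt K).symm (exp (-m))} := by
  ext x
  by_cases hx : x = 0
  · simp [hx, zero_mem]
  simp only [SetLike.mem_coe, mem_fracIdeal_of_ne_zero hx, Set.mem_ofPred_eq, ord]
  rw [← (valueGroupWithZeroIsoInt K).strictMono.le_iff_le, OrderMonoidIso.apply_symm_apply,
    ← log_le_log (valueGroup_ne_zero hx) exp_ne_zero, log_exp]
  omega

variable (K) in
theorem isCompact_fracIdeal (m : ℤ) : IsCompact (fracIdeal K m : Set K) := by
  rw [coe_fracIdeal_eq_closedBall]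
  exact isCompact_closedBall K _

theorem mem_nhds_zero_iff_fracIdeal {s : Set K} :
    s ∈ nhds (0 : K) ↔ ∃ m, (fracIdeal K m : Set K) ⊆ s := by
  rw [(IsValuativeTopology.hasBasis_nhds_zero' K).mem_iff]
  constructor
  · rintro ⟨γ, hγ, h⟩
    have hγ' : valueGroupWithZeroIsoInt K γ ≠ 0 := by simpa using hγ
    refine ⟨1 - log (valueGroupWithZeroIsoInt K γ), fun x hx ↦ h ?_⟩
    rw [SetLike.mem_coe] at hx
    simp only [Set.mem_ofPred_eq]
    by_cases hx0 : x = 0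
    · simpa [hx0] using zero_lt_iff.2 hγ
    rw [mem_fracIdeal_of_ne_zero hx0, ord] at hx
    rw [← (valueGroupWithZeroIsoInt K).strictMono.lt_iff_lt, ← log_lt_log (valueGroup_ne_zero hx0) hγ']
    omega
  · rintro ⟨m, h⟩
    refine ⟨(valueGroupWithZeroIsoInt K).symm (exp (-m)), by simp, fun x hx ↦ h ?_⟩
    rw [coe_fracIdeal_eq_closedBall]
    simp only [Set.mem_ofPred_eq] at hx ⊢
    exact hx.le

theorem isOpen_fracIdeal (m : ℤ) : IsOpen (fracIdeal K m : Set K) :=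
  AddSubgroup.isOpen_of_mem_nhds _ (mem_nhds_zero_iff_fracIdeal.2 ⟨m, subset_rfl⟩)

end Ord

/-! ### Schwartz-Bruhat functions through support and invariance levels. -/

section Schwartz

variable {K : Type*} [Field K] [ValuativeRel K] [TopologicalSpace K] [IsNonarchimedeanLocalField K]

theorem isOpen_sub_mem_fracIdeal (x : K) (m : ℤ) :
    IsOpen {y : K | y - x ∈ fracIdeal K m} :=
  (isOpen_fracIdeal m).preimage (continuous_id.sub continuous_const)

theorem exists_subset_fracIdeal {s : Set K} (hs : IsCompact s) :
    ∃ a, s ⊆ (fracIdeal K a : Set K) := by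
  refine hs.induction_on ?_ ?_ ?_ ?_
  · exact ⟨0, by simp⟩
  · intro s t hst h
    exact h.imp fun a ha ↦ hst.trans ha
  · rintro s t ⟨a, ha⟩ ⟨b, hb⟩
    exact ⟨min a b, Set.union_subset (fun x hx ↦ fracIdeal_anti (min_le_left a b) (ha hx))
      (fun x hx ↦ fracIdeal_anti (min_le_right a b) (hb hx))⟩
  · intro x hx
    exact ⟨fracIdeal K (ord K x), mem_nhdsWithin_of_mem_nhds
      ((isOpen_fracIdeal _).mem_nhds (self_mem_fracIdeal x)), ord K x, subset_rfl⟩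

theorem exists_translation_invariant {f : K → ℂ} (hf : IsLocallyConstant f) {s : Set K}
    (hs : IsCompact s) : ∃ b, ∀ x ∈ s, ∀ t ∈ fracIdeal K b, f (x + t) = f x := by
  refine hs.induction_on ?_ ?_ ?_ ?_
  · exact ⟨0, by simp⟩
  · intro s t hst h
    exact h.imp fun a ha x hx ↦ ha x (hst hx)
  · rintro s t ⟨a, ha⟩ ⟨b, hb⟩
    refine ⟨max a b, ?_⟩
    rintro x (hx | hx) t ht
    · exact ha x hx t (fracIdeal_anti (le_max_left a b) ht)
    · exact hb x hx t (fracIdeal_anti (le_max_right a b) ht)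
  · intro x hx
    have h1 : {t | f (x + t) = f x} ∈ nhds (0 : K) := by
      have h2 : Filter.Tendsto (fun t ↦ x + t) (nhds 0) (nhds x) := by
        simpa using (continuous_const_add x).tendsto 0
      exact h2 (hf.eventually_eq x)
    obtain ⟨b, hb⟩ := mem_nhds_zero_iff_fracIdeal.1 h1
    refine ⟨{y | y - x ∈ fracIdeal K b}, mem_nhdsWithin_of_mem_nhds
      ((isOpen_sub_mem_fracIdeal x b).mem_nhds (by simp)), b, fun y hy t ht ↦ ?_⟩
    have e1 := hb hy
    have e2 := hb (add_mem hy ht)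
    simp only [Set.mem_ofPred_eq] at e1 e2
    rw [show x + (y - x) = y by ring] at e1
    rw [show x + (y - x + t) = y + t by ring] at e2
    rw [e1, e2]

/-- `f` is supported in the fractional ideal of level `a` and invariant under translation by the
fractional ideal of level `b`. -/
structure HasLevel (a b : ℤ) (f : K → ℂ) : Prop where
  supp : ∀ x, x ∉ fracIdeal K a → f x = 0
  inv : ∀ x, ∀ t ∈ fracIdeal K b, f (x + t) = f x

theorem HasLevel.mem {a b : ℤ} {f : K → ℂ} (hf : HasLevel a b f) : f ∈ SchwartzBruhat K := by
  refine ⟨(IsLocallyConstant.iff_eventually_eq _).2 fun x ↦ ?_,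
    HasCompactSupport.intro (isCompact_fracIdeal K a) fun x hx ↦ hf.supp x hx⟩
  filter_upwards [(isOpen_sub_mem_fracIdeal x b).mem_nhds (by simp [zero_mem])] with y hy
  simpa using hf.inv x (y - x) hy

theorem exists_hasLevel {f : K → ℂ} (hf : f ∈ SchwartzBruhat K) : ∃ a b, HasLevel a b f := by
  obtain ⟨a, ha⟩ := exists_subset_fracIdeal hf.2
  have hsupp : ∀ x, x ∉ fracIdeal K a → f x = 0 := fun x hx ↦
    image_eq_zero_of_notMem_tsupport fun h ↦ hx (ha h)
  obtain ⟨b, hb⟩ := exists_translation_invariant hf.1 (isCompact_fracIdeal K a)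
  -- The maximum makes translations preserve the complement of the supporting ideal as well.
  refine ⟨a, max a b, hsupp, fun x t ht ↦ ?_⟩
  by_cases hx : x ∈ fracIdeal K a
  · exact hb x hx t (fracIdeal_anti (le_max_right a b) ht)
  · rw [hsupp x hx, hsupp]
    exact (ord_add_of_notMem hx (fracIdeal_anti (le_max_left a b) ht)).1

theorem HasLevel.const {a b : ℤ} {f : K → ℂ} (hf : HasLevel a b f) {x : K}
    (hx : x ∈ fracIdeal K b) : f x = f 0 := by
  simpa using hf.inv 0 x hx

theorem HasLevel.mono {a b a' b' : ℤ} {f : K → ℂ} (hf : HasLevel a b f) (ha : a' ≤ a)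
    (hb : b ≤ b') : HasLevel a' b' f :=
  ⟨fun x hx ↦ hf.supp x fun h ↦ hx (fracIdeal_anti ha h),
    fun x t ht ↦ hf.inv x t (fracIdeal_anti hb ht)⟩

/-- The indicator function of a fractional ideal. -/
def ball (m : ℤ) : K → ℂ := (fracIdeal K m : Set K).indicator 1

theorem ball_of_mem {m : ℤ} {x : K} (hx : x ∈ fracIdeal K m) : ball m x = 1 :=
  Set.indicator_of_mem (s := (fracIdeal K m : Set K)) hx 1

theorem ball_of_notMem {m : ℤ} {x : K} (hx : x ∉ fracIdeal K m) : ball m x = 0 :=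
  Set.indicator_of_notMem (s := (fracIdeal K m : Set K)) hx 1

theorem hasLevel_ball (m : ℤ) : HasLevel m m (ball m : K → ℂ) where
  supp _ hx := ball_of_notMem hx
  inv x t ht := by
    by_cases hx : x ∈ fracIdeal K m
    · rw [ball_of_mem hx, ball_of_mem (add_mem hx ht)]
    · rw [ball_of_notMem hx, ball_of_notMem (ord_add_of_notMem hx ht).1]

theorem ball_mem (m : ℤ) : (ball m : K → ℂ) ∈ SchwartzBruhat K := (hasLevel_ball m).mem

/-- Dilations preserve the Schwartz-Bruhat space. -/
theorem comp_mul_mem {f : K → ℂ} (hf : f ∈ SchwartzBruhat K) {a : K} (ha : a ≠ 0) :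
    (fun x ↦ f (a * x)) ∈ SchwartzBruhat K :=
  ⟨hf.1.comp_continuous (continuous_const.mul continuous_id),
    hf.2.comp_homeomorph (Homeomorph.mulLeft₀ a ha)⟩

open Classical in
/-- The restriction of `f` to the elements whose valuation lies in `Q`. -/
def shells (Q : Set ℤ) (f : K → ℂ) (x : K) : ℂ := if x ≠ 0 ∧ ord K x ∈ Q then f x else 0

theorem shells_of_mem {Q : Set ℤ} {f : K → ℂ} {x : K} (hx : x ≠ 0) (h : ord K x ∈ Q) :
    shells Q f x = f x := if_pos ⟨hx, h⟩

theorem shells_of_notMem {Q : Set ℤ} {f : K → ℂ} {x : K} (h : ord K x ∉ Q) :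
    shells Q f x = 0 := if_neg fun h' ↦ h h'.2

@[simp] theorem shells_zero (Q : Set ℤ) (f : K → ℂ) : shells Q f 0 = 0 := if_neg fun h ↦ h.1 rfl

/-- The valuation is locally constant away from `0`, so truncation can spoil local constancy only at
the origin, where `f` is assumed to vanish. -/
theorem hasLevel_shells {a b m : ℤ} {f : K → ℂ} (hf : HasLevel a b f)
    (h0 : ∀ x ∈ fracIdeal K m, f x = 0) (Q : Set ℤ) : HasLevel a (max b m) (shells Q f) where
  supp x hx := by unfold shells; split_ifs <;> simp [hf.supp x hx]
  inv x t ht := by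
    by_cases hx : x ∈ fracIdeal K m
    · have hxt := add_mem hx (fracIdeal_anti (le_max_right b m) ht)
      simp [shells, h0 x hx, h0 _ hxt]
    · obtain ⟨h1, h2⟩ := ord_add_of_notMem hx (fracIdeal_anti (le_max_right b m) ht)
      by_cases hQ : ord K x ∈ Q
      · rw [shells_of_mem (notMem_fracIdeal.1 hx).1 hQ,
          shells_of_mem (notMem_fracIdeal.1 h1).1 (h2 ▸ hQ),
          hf.inv x t (fracIdeal_anti (le_max_left b m) ht)]
      · rw [shells_of_notMem hQ, shells_of_notMem (h2 ▸ hQ)]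

end Schwartz

/-! ### The maps of `K` behind `W` and `∇`. -/

section Fold

variable {K : Type*} [Field K] [ValuativeRel K] [TopologicalSpace K] [IsNonarchimedeanLocalField K]

/-- The map by which `W` precomposes: it halves the valuation, rounding down. -/
def fold (π : K) (x : K) : K := π ^ (-((ord K x + 1) / 2)) * x

theorem W_eq_comp_fold (π : K) (g : K → ℂ) (x : K) : W π g x = g (fold π x) := by
  unfold W fold
  split_ifs with h1 h2
  · simp [h1]
  · obtain ⟨m, hm⟩ := h2
    congr 3; omega
  · obtain ⟨m, hm⟩ := Int.not_even_iff_odd.1 h2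
    congr 3; omega

variable {π : K} (hπ : ord K π = 1)
include hπ

theorem uniformizer_ne_zero : π ≠ 0 := by
  rintro rfl
  simp at hπ

theorem ord_uniformizer_zpow_mul (n : ℤ) {x : K} (hx : x ≠ 0) :
    ord K (π ^ n * x) = n + ord K x := by
  rw [ord_mul (zpow_ne_zero _ (uniformizer_ne_zero hπ)) hx, ord_zpow, hπ, mul_one]

theorem uniformizer_zpow_mem (n : ℤ) : π ^ n ∈ fracIdeal K n := by
  refine Or.inr ?_
  rw [ord_zpow, hπ, mul_one]

theorem fold_ne_zero {x : K} (hx : x ≠ 0) : fold π x ≠ 0 :=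
  mul_ne_zero (zpow_ne_zero _ (uniformizer_ne_zero hπ)) hx

theorem ord_fold (x : K) : ord K (fold π x) = ord K x / 2 := by
  by_cases hx : x = 0
  · simp [hx, fold]
  rw [fold, ord_uniformizer_zpow_mul hπ _ hx]
  omega

theorem nabla_ne_zero {x : K} (hx : x ≠ 0) : nabla π x ≠ 0 :=
  mul_ne_zero (zpow_ne_zero _ (uniformizer_ne_zero hπ)) hx

theorem ord_nabla (x : K) : ord K (nabla π x) = 2 * ord K x := by
  by_cases hx : x = 0
  · simp [hx, nabla]
  rw [nabla, ord_uniformizer_zpow_mul hπ _ hx]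
  omega

theorem fold_nabla (x : K) : fold π (nabla π x) = x := by
  rw [fold, ord_nabla hπ, nabla, ← mul_assoc, ← zpow_add₀ (uniformizer_ne_zero hπ)]
  rw [show -((2 * ord K x + 1) / 2) + ord K x = 0 by omega]
  simp

theorem fold_mul_nabla (x : K) : fold π (π * nabla π x) = x := by
  by_cases hx : x = 0
  · simp [hx, fold, nabla]
  have h0 := uniformizer_ne_zero hπ
  rw [fold, ord_mul h0 (nabla_ne_zero hπ hx), ord_nabla hπ, hπ, nabla]
  rw [show -((1 + 2 * ord K x + 1) / 2) = -(ord K x) - 1 by omega]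
  rw [zpow_sub_one₀ h0, zpow_neg]
  field_simp

theorem nabla_fold_of_even {x : K} (hx : Even (ord K x)) : nabla π (fold π x) = x := by
  obtain ⟨m, hm⟩ := hx
  rw [nabla, ord_fold hπ, fold, ← mul_assoc, ← zpow_add₀ (uniformizer_ne_zero hπ)]
  rw [show ord K x / 2 + -((ord K x + 1) / 2) = 0 by omega]
  simp

theorem nabla_fold_of_odd {x : K} (hx : Odd (ord K x)) : nabla π (fold π x) = π⁻¹ * x := by
  obtain ⟨m, hm⟩ := hx
  rw [nabla, ord_fold hπ, fold, ← mul_assoc, ← zpow_add₀ (uniformizer_ne_zero hπ)]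
  rw [show ord K x / 2 + -((ord K x + 1) / 2) = -1 by omega]
  simp

/-- Near the origin `W π g` is the constant `g 0`. Off the ideal of level `2 * b` a translation by
`t` leaves the valuation unchanged, so it moves `fold π x` by a power of `π` times `t`, still of
level `b`. -/
theorem hasLevel_W {a b : ℤ} {g : K → ℂ} (hg : HasLevel a b g) :
    HasLevel (2 * a) (2 * b) (W π g) where
  supp x hx := by
    rw [W_eq_comp_fold]
    obtain ⟨hx0, hx⟩ := notMem_fracIdeal.1 hx
    refine hg.supp _ (notMem_fracIdeal.2 ⟨fold_ne_zero hπ hx0, ?_⟩)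
    rw [ord_fold hπ]
    omega
  inv x t ht := by
    have key : ∀ y ∈ fracIdeal K (2 * b), g (fold π y) = g 0 := by
      rintro y (rfl | hy)
      · simp [fold]
      · exact hg.const (Or.inr (by rw [ord_fold hπ]; omega))
    rw [W_eq_comp_fold, W_eq_comp_fold]
    by_cases hx : x ∈ fracIdeal K (2 * b)
    · rw [key _ hx, key _ (add_mem hx ht)]
    · obtain ⟨h1, h2⟩ := ord_add_of_notMem hx ht
      have hx' := (notMem_fracIdeal.1 hx).2
      rw [fold, h2, mul_add]
      refine hg.inv _ _ (fracIdeal_anti ?_ (mul_mem_fracIdeal (uniformizer_zpow_mem hπ _) ht))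
      omega

theorem W_mem {g : K → ℂ} (hg : g ∈ SchwartzBruhat K) : W π g ∈ SchwartzBruhat K := by
  obtain ⟨a, b, h⟩ := exists_hasLevel hg
  exact (hasLevel_W hπ h).mem

theorem comp_nabla_mem {f : K → ℂ} (hf : f ∈ SchwartzBruhat K) :
    (fun x ↦ f (nabla π x)) ∈ SchwartzBruhat K := by
  obtain ⟨a, b, h⟩ := exists_hasLevel hf
  have hsupp : ∀ x, x ∉ fracIdeal K (-|a|) → f (nabla π x) = 0 := by
    intro x hx
    obtain ⟨hx0, hx⟩ := notMem_fracIdeal.1 hx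
    refine h.supp _ (notMem_fracIdeal.2 ⟨nabla_ne_zero hπ hx0, ?_⟩)
    rw [ord_nabla hπ]
    have := neg_abs_le a
    have := abs_nonneg a
    omega
  have hb : ∀ x ∈ fracIdeal K |b|, f (nabla π x) = f 0 := by
    rintro x (rfl | hx)
    · simp [nabla]
    · refine h.const (Or.inr ?_)
      rw [ord_nabla hπ]
      have := le_abs_self b
      have := abs_nonneg b
      omega
  -- Away from the origin `nabla` moves by `π ^ ord K x * t`; on the support `ord K x ≥ -|a|`, a
  -- loss that the summand `|a|` absorbs.
  refine HasLevel.mem (a := -|a|) (b := |a| + |b|) ⟨hsupp, fun x t ht ↦ ?_⟩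
  have htb : t ∈ fracIdeal K |b| := fracIdeal_anti (by linarith [abs_nonneg a]) ht
  by_cases hxb : x ∈ fracIdeal K |b|
  · rw [hb _ hxb, hb _ (add_mem hxb htb)]
  by_cases hxa : x ∈ fracIdeal K (-|a|)
  · rw [nabla, (ord_add_of_notMem hxb htb).2, mul_add]
    refine h.inv _ _ (fracIdeal_anti ?_ (mul_mem_fracIdeal (uniformizer_zpow_mem hπ _) ht))
    rw [mem_fracIdeal_of_ne_zero (notMem_fracIdeal.1 hxb).1] at hxa
    linarith [le_abs_self b]
  · rw [hsupp x hxa, hsupp]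
    exact (ord_add_of_notMem hxa (fracIdeal_anti
      (by linarith [abs_nonneg a, abs_nonneg b]) ht)).1

end Fold

theorem fourier_smul {K : Type*} [Field K] [MeasurableSpace K] (μ : Measure K)
    {ψ : AddChar K Circle} (c : ℂ) (f : K → ℂ) (y : K) :
    fourier ψ μ (c • f) y = c * fourier ψ μ f y := by
  simp only [fourier, Pi.smul_apply, smul_eq_mul, mul_assoc]
  exact integral_const_mul _ _

theorem integrable_of_mem {K : Type*} [Field K] [TopologicalSpace K] [MeasurableSpace K]
    [BorelSpace K] (μ : Measure K) [μ.IsAddHaarMeasure] {f : K → ℂ} (hf : f ∈ SchwartzBruhat K) : Integrable f μ :=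
  hf.1.continuous.integrable_of_hasCompactSupport hf.2

/-! ### Additive characters and their conductors. -/

section Character

variable {K : Type*} [Field K] [ValuativeRel K] [TopologicalSpace K] [IsNonarchimedeanLocalField K]

/-- Squaring near `1` expands the distance to `1`, because `z² - 1 = (z + 1)(z - 1)` and `z + 1` is
close to `2`. Iteration drives any nontrivial `z` out of the neighbourhood. -/
theorem circle_expansion (z : Circle) (hz : ‖(z : ℂ) - 1‖ ≤ 1 / 2) :
    3 / 2 * ‖(z : ℂ) - 1‖ ≤ ‖((z ^ 2 : Circle) : ℂ) - 1‖ := by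
  have h1 : ((z ^ 2 : Circle) : ℂ) - 1 = ((z : ℂ) + 1) * ((z : ℂ) - 1) := by
    rw [Circle.coe_pow]; ring
  have h2 : (2 : ℝ) - ‖(z : ℂ) - 1‖ ≤ ‖(z : ℂ) + 1‖ := by
    have := norm_sub_norm_le (2 : ℂ) (-((z : ℂ) - 1))
    rw [norm_neg, show (2 : ℂ) - -((z : ℂ) - 1) = z + 1 by ring] at this
    simpa using this
  rw [h1, norm_mul]
  exact mul_le_mul_of_nonneg_right (by linarith) (norm_nonneg _)

/-- The circle has no small subgroups. -/
theorem circle_eq_one_of_pow_near (z : Circle)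
    (hz : ∀ n : ℕ, ‖((z ^ n : Circle) : ℂ) - 1‖ ≤ 1 / 2) : z = 1 := by
  have h1 : ∀ n : ℕ, (3 / 2 : ℝ) ^ n * ‖(z : ℂ) - 1‖ ≤ ‖((z ^ (2 ^ n) : Circle) : ℂ) - 1‖ := by
    intro n
    induction n with
    | zero => simp
    | succ n ih =>
      have h2 := circle_expansion (z ^ (2 ^ n)) (hz _)
      rw [← pow_mul, ← pow_succ] at h2
      rw [pow_succ]
      linarith
  by_contra hne
  have hpos : 0 < ‖(z : ℂ) - 1‖ := by
    rw [norm_pos_iff, sub_ne_zero]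
    exact fun h ↦ hne (Circle.ext (by rw [h, Circle.coe_one]))
  obtain ⟨n, hn⟩ := pow_unbounded_of_one_lt (1 / ‖(z : ℂ) - 1‖) (by norm_num : (1 : ℝ) < 3 / 2)
  rw [div_lt_iff₀ hpos] at hn
  linarith [h1 n, hz (2 ^ n)]

/-- `ψ` is trivial on the fractional ideal of level `d`, and `d` is minimal. -/
structure IsConductor (ψ : AddChar K Circle) (d : ℤ) : Prop where
  eq_one : ∀ x ∈ fracIdeal K d, ψ x = 1
  exists_ne_one : ∃ x ∈ fracIdeal K (d - 1), ψ x ≠ 1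

theorem exists_isConductor {ψ : AddChar K Circle} (hψ : Continuous ψ) (hψ1 : ψ ≠ 1) :
    ∃ d, IsConductor ψ d := by
  obtain ⟨x₀, hx₀⟩ := AddChar.ne_one_iff.1 hψ1
  have hc : Continuous fun x ↦ ‖(ψ x : ℂ) - 1‖ := by fun_prop
  have hnhds : {x | ‖(ψ x : ℂ) - 1‖ ≤ 1 / 2} ∈ nhds (0 : K) := by
    have : {x | ‖(ψ x : ℂ) - 1‖ < 1 / 2} ∈ nhds (0 : K) :=
      (isOpen_lt hc continuous_const).mem_nhds (by simp)
    exact Filter.mem_of_superset this fun x hx ↦ by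
      simp only [Set.mem_ofPred_eq] at hx ⊢
      exact hx.le
  obtain ⟨m, hm⟩ := mem_nhds_zero_iff_fracIdeal.1 hnhds
  -- Nontriviality at `x₀` bounds the levels below; a level exists since a small fractional ideal
  -- has image a subgroup close to `1`.
  obtain ⟨d, hd, hmin⟩ := Int.exists_least_of_bdd (P := fun m ↦ ∀ x ∈ fracIdeal K m, ψ x = 1)
    ⟨ord K x₀, fun m h ↦ le_of_not_gt fun hlt ↦ hx₀ (h x₀ (Or.inr hlt.le))⟩
    ⟨m, fun x hx ↦ circle_eq_one_of_pow_near _ fun n ↦ by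
      rw [← AddChar.map_nsmul_eq_pow]
      exact hm (nsmul_mem hx n)⟩
  refine ⟨d, hd, ?_⟩
  by_contra! h
  linarith [hmin _ h]

theorem IsConductor.exists_mul_ne_one {ψ : AddChar K Circle} {d : ℤ} (hd : IsConductor ψ d)
    {m : ℤ} {y : K} (hy : y ∉ fracIdeal K (d - m)) : ∃ t ∈ fracIdeal K m, ψ (t * y) ≠ 1 := by
  obtain ⟨s, hs, hs1⟩ := hd.exists_ne_one
  obtain ⟨hy0, hy⟩ := notMem_fracIdeal.1 hy
  refine ⟨y⁻¹ * s, ?_, by rwa [mul_comm, mul_inv_cancel_left₀ hy0]⟩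
  rw [mul_mem_fracIdeal_iff (inv_ne_zero hy0), ord_inv]
  exact fracIdeal_anti (by omega) hs

theorem IsConductor.mul_eq_one {ψ : AddChar K Circle} {d : ℤ} (hd : IsConductor ψ d)
    {m : ℤ} {x y : K} (hx : x ∈ fracIdeal K m) (hy : y ∈ fracIdeal K (d - m)) :
    ψ (x * y) = 1 :=
  hd.eq_one _ (by simpa using mul_mem_fracIdeal hx hy)

theorem ball_mul {a : K} (ha : a ≠ 0) (m : ℤ) (x : K) :
    ball m (a * x) = ball (m - ord K a) x := by
  by_cases hx : x ∈ fracIdeal K (m - ord K a)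
  · rw [ball_of_mem hx, ball_of_mem ((mul_mem_fracIdeal_iff ha).2 hx)]
  · rw [ball_of_notMem hx, ball_of_notMem fun h ↦ hx ((mul_mem_fracIdeal_iff ha).1 h)]

theorem continuous_mul_char {ψ : AddChar K Circle} (hψ : Continuous ψ) {f : K → ℂ} (hf : Continuous f) (y : K) :
    Continuous fun x ↦ f x * (ψ (x * y) : ℂ) := by fun_prop

end Character

/-! ### Dilation of Haar measure and Fourier inversion. -/

section Integral

variable {K : Type*} [Field K] [ValuativeRel K] [TopologicalSpace K] [IsNonarchimedeanLocalField K]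
  [MeasurableSpace K] [BorelSpace K] (μ : Measure K) [μ.IsAddHaarMeasure]

/-- Haar integrals of continuous functions scale under dilations. -/
theorem exists_integral_comp_mul {a : K} (ha : a ≠ 0) : ∃ c : ℂ, ∀ f : K → ℂ, Continuous f →
    HasCompactSupport f → ∫ x, f (a * x) ∂μ = c * ∫ x, f x ∂μ := by
  let e : K ≃ₜ+ K :=
    { Homeomorph.mulLeft₀ a ha with
      map_add' := fun x y ↦ mul_add a x y }
  have he : ∀ x, e x = a * x := fun _ ↦ rfl
  have : (μ.map e).IsAddHaarMeasure := e.isAddHaarMeasure_map μ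
  obtain ⟨c, hc⟩ :=
    Measure.exists_integral_isAddLeftInvariant_eq_smul_of_hasCompactSupport (μ.map e) μ
  have hmap : ∀ g : K → ℝ, ∫ x, g x ∂(μ.map e) = ∫ x, g (a * x) ∂μ := fun g ↦
    e.toHomeomorph.measurableEmbedding.integral_map g
  refine ⟨c, fun f hf hf' ↦ ?_⟩
  have hf1 : Integrable f μ := hf.integrable_of_hasCompactSupport hf'
  have hf2 : Integrable (fun x ↦ f (a * x)) μ :=
    (hf.comp (continuous_const_mul a)).integrable_of_hasCompactSupport
      (hf'.comp_homeomorph (Homeomorph.mulLeft₀ a ha))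
  -- Uniqueness of Haar measure is applied in its real-valued form, to real and imaginary parts with
  -- the same constant.
  have hre := hc (fun x ↦ (f x).re) (by fun_prop) (hf'.comp_left (g := Complex.re) rfl)
  have him := hc (fun x ↦ (f x).im) (by fun_prop) (hf'.comp_left (g := Complex.im) rfl)
  rw [hmap, integral_smul_nnreal_measure] at hre him
  have hre1 : ∫ x, (f x).re ∂μ = (∫ x, f x ∂μ).re := integral_re hf1
  have him1 : ∫ x, (f x).im ∂μ = (∫ x, f x ∂μ).im := integral_im hf1
  have hre2 : ∫ x, (f (a * x)).re ∂μ = (∫ x, f (a * x) ∂μ).re := integral_re hf2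
  have him2 : ∫ x, (f (a * x)).im ∂μ = (∫ x, f (a * x) ∂μ).im := integral_im hf2
  rw [hre1, hre2] at hre
  rw [him1, him2] at him
  refine Complex.ext ?_ ?_
  · rw [hre, NNReal.smul_def, smul_eq_mul, ← Complex.re_ofReal_mul]
  · rw [him, NNReal.smul_def, smul_eq_mul, ← Complex.im_ofReal_mul]

/-- The total mass of a fractional ideal. -/
def vol (m : ℤ) : ℂ := ∫ x, ball m x ∂μ

theorem vol_ne_zero (m : ℤ) : vol μ m ≠ 0 := by
  have h : vol μ m = (μ.real (fracIdeal K m : Set K) : ℂ) := by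
    rw [vol, ball, integral_indicator (isOpen_fracIdeal m).measurableSet]
    simp
  rw [h]
  norm_cast
  refine (ENNReal.toReal_pos ((isOpen_fracIdeal m).measure_pos μ ⟨0, zero_mem _⟩).ne'
    (isCompact_fracIdeal K m).measure_lt_top.ne).ne'

/-- The factor by which the dilation by `a` scales the Haar integral. -/
def dilationFactor (a : K) : ℂ := vol μ (-ord K a) / vol μ 0

theorem dilationFactor_ne_zero (a : K) : dilationFactor μ a ≠ 0 :=
  div_ne_zero (vol_ne_zero μ _) (vol_ne_zero μ _)

theorem dilationFactor_of_ord_eq_zero {a : K} (ha : ord K a = 0) : dilationFactor μ a = 1 := by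
  rw [dilationFactor, ha, neg_zero, div_self (vol_ne_zero μ 0)]

theorem integral_comp_mul {a : K} (ha : a ≠ 0) {f : K → ℂ} (hf : Continuous f)
    (hf' : HasCompactSupport f) : ∫ x, f (a * x) ∂μ = dilationFactor μ a * ∫ x, f x ∂μ := by
  obtain ⟨c, hc⟩ := exists_integral_comp_mul μ ha
  -- The test function `ball 0` identifies the constant.
  have h := hc (ball 0) (ball_mem 0).1.continuous (ball_mem 0).2
  simp_rw [ball_mul ha, zero_sub] at h
  change vol μ (-ord K a) = c * vol μ 0 at h
  rw [hc f hf hf', dilationFactor, h, mul_div_cancel_right₀ _ (vol_ne_zero μ 0)]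

theorem vol_sub_ord {a : K} (ha : a ≠ 0) (m : ℤ) :
    vol μ (m - ord K a) = dilationFactor μ a * vol μ m := by
  have h := integral_comp_mul μ ha (ball_mem m).1.continuous (ball_mem m).2
  simp_rw [ball_mul ha] at h
  exact h

/-- Products of volumes depend only on the sum of the levels. -/
theorem vol_mul_vol {π : K} (hπ : ord K π = 1) {m n m' n' : ℤ} (h : m + n = m' + n') :
    vol μ m * vol μ n = vol μ m' * vol μ n' := by
  have h1 : ∀ i k : ℤ, vol μ (k - i) = dilationFactor μ (π ^ i) * vol μ k := by
    intro i k
    have hne : π ^ i ≠ 0 := zpow_ne_zero _ (uniformizer_ne_zero hπ)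
    rw [← vol_sub_ord μ hne, ord_zpow, hπ, mul_one]
  have e1 := h1 (m' - m) m'
  have e2 := h1 (m' - m) n
  rw [show m' - (m' - m) = m by ring] at e1
  rw [show n - (m' - m) = n' by omega] at e2
  rw [e1, e2]
  ring

variable {ψ : AddChar K Circle} (hψ : Continuous ψ)

section

include hψ

theorem integrable_mul_char {f : K → ℂ} (hf : f ∈ SchwartzBruhat K) (y : K) :
    Integrable (fun x ↦ f x * (ψ (x * y) : ℂ)) μ :=
  (continuous_mul_char hψ hf.1.continuous y).integrable_of_hasCompactSupport hf.2.mul_right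

theorem fourier_add {f g : K → ℂ} (hf : f ∈ SchwartzBruhat K) (hg : g ∈ SchwartzBruhat K) (y : K) :
    fourier ψ μ (f + g) y = fourier ψ μ f y + fourier ψ μ g y := by
  simp only [fourier, Pi.add_apply, add_mul]
  exact integral_add (integrable_mul_char μ hψ hf y) (integrable_mul_char μ hψ hg y)

theorem fourier_sub {f g : K → ℂ} (hf : f ∈ SchwartzBruhat K) (hg : g ∈ SchwartzBruhat K) (y : K) :
    fourier ψ μ (f - g) y = fourier ψ μ f y - fourier ψ μ g y := by
  simp only [fourier, Pi.sub_apply, sub_mul]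
  exact integral_sub (integrable_mul_char μ hψ hf y) (integrable_mul_char μ hψ hg y)

theorem fourier_comp_mul {f : K → ℂ} (hf : f ∈ SchwartzBruhat K) {a : K} (ha : a ≠ 0) (y : K) :
    fourier ψ μ (fun x ↦ f (a * x)) y = dilationFactor μ a * fourier ψ μ f (a⁻¹ * y) := by
  have h := integral_comp_mul μ ha (continuous_mul_char hψ hf.1.continuous (a⁻¹ * y))
    hf.2.mul_right
  rw [fourier, fourier, ← h]
  congr 1
  ext x
  rw [show a * x * (a⁻¹ * y) = x * y by field_simp]

end

/-- The substitution `x ↦ x + t` multiplies the transform at `y` by `ψ (t * y)`. -/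
theorem fourier_eq_zero_of_translation {f : K → ℂ} {t y : K} (hf : ∀ x, f (x + t) = f x)
    (ht : ψ (t * y) ≠ 1) : fourier ψ μ f y = 0 := by
  have h : fourier ψ μ f y = fourier ψ μ f y * (ψ (t * y) : ℂ) := by
    conv_lhs => rw [fourier, ← integral_add_right_eq_self _ t]
    rw [fourier, ← integral_mul_const]
    congr 1
    ext x
    rw [hf, add_mul, AddChar.map_add_eq_mul, Circle.coe_mul, mul_assoc]
  by_contra h0
  refine ht (Circle.ext ?_)
  rw [Circle.coe_one]
  exact mul_left_cancel₀ h0 (by rw [← h, mul_one])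

variable {d : ℤ} (hd : IsConductor ψ d)
include hd

theorem hasLevel_fourier {a b : ℤ} {f : K → ℂ} (hf : HasLevel a b f) :
    HasLevel (d - b) (d - a) (fourier ψ μ f) where
  supp y hy := by
    obtain ⟨t, ht, h⟩ := hd.exists_mul_ne_one hy
    exact fourier_eq_zero_of_translation μ (fun x ↦ hf.inv x t ht) h
  inv y t ht := by
    unfold fourier
    congr 1
    ext x
    by_cases hx : x ∈ fracIdeal K a
    · rw [mul_add, AddChar.map_add_eq_mul, hd.mul_eq_one hx ht, mul_one]
    · simp [hf.supp x hx]

theorem fourier_mem {f : K → ℂ} (hf : f ∈ SchwartzBruhat K) :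
    fourier ψ μ f ∈ SchwartzBruhat K := by
  obtain ⟨a, b, h⟩ := exists_hasLevel hf
  exact (hasLevel_fourier μ hd h).mem

theorem fourier_ball (m : ℤ) (y : K) : fourier ψ μ (ball m) y = vol μ m * ball (d - m) y := by
  by_cases hy : y ∈ fracIdeal K (d - m)
  · have h := (hasLevel_fourier μ hd (hasLevel_ball m)).const hy
    rw [h, ball_of_mem hy]
    simp [fourier, vol]
  · rw [(hasLevel_fourier μ hd (hasLevel_ball m)).supp y hy, ball_of_notMem hy, mul_zero]

include hψ

/-- Fourier inversion on the Schwartz-Bruhat space. -/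
theorem fourier_fourier {π : K} (hπ : ord K π = 1) {f : K → ℂ} (hf : f ∈ SchwartzBruhat K)
    (x : K) : fourier ψ μ (fourier ψ μ f) x = vol μ 0 * vol μ d * f (-x) := by
  obtain ⟨a, b, hab⟩ := exists_hasLevel hf
  have hF := hasLevel_fourier μ hd hab
  -- The transform of `f` is supported at level `d - b`, so a factor `ball (d - b) y` is harmless;
  -- it gives the double integrand compact support, as the interchange of integrals needs.
  have h1 : ∀ y, fourier ψ μ f y * (ψ (y * x) : ℂ) =
      ∫ z, f z * ball (d - b) y * (ψ (z * y) : ℂ) * (ψ (y * x) : ℂ) ∂μ := by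
    intro y
    rw [integral_mul_const]
    congr 1
    by_cases hy : y ∈ fracIdeal K (d - b)
    · simp [fourier, ball_of_mem hy]
    · simp [hF.supp y hy, ball_of_notMem hy]
  have h2 : ∀ z, ∫ y, f z * ball (d - b) y * (ψ (z * y) : ℂ) * (ψ (y * x) : ℂ) ∂μ =
      f (-x) * vol μ (d - b) * ball b (z + x) := by
    intro z
    have h3 := fourier_ball μ hd (d - b) (z + x)
    rw [sub_sub_cancel, fourier] at h3
    have h4 : f z * ball b (z + x) = f (-x) * ball b (z + x) := by
      by_cases hz : z + x ∈ fracIdeal K b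
      · rw [← hab.inv (-x) _ hz]
        congr 2; ring
      · simp [ball_of_notMem hz]
    rw [mul_right_comm, ← h4, mul_assoc, mul_comm (ball b _), ← h3, ← integral_const_mul]
    congr 1
    ext y
    rw [mul_add, AddChar.map_add_eq_mul, Circle.coe_mul, mul_comm y z]
    ring
  rw [fourier]
  simp_rw [h1]
  rw [integral_integral_swap_of_hasCompactSupport]
  · simp_rw [h2]
    rw [integral_const_mul, integral_add_right_eq_self (fun z ↦ ball b z) x]
    change _ * vol μ b = _
    rw [vol_mul_vol μ hπ (show (0 : ℤ) + d = (d - b) + b by ring)]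
    ring
  · have := hf.1.continuous
    have := (ball_mem (K := K) (d - b)).1.continuous
    simp only [Function.uncurry_def]
    fun_prop
  · refine HasCompactSupport.intro
      ((isCompact_fracIdeal K (d - b)).prod (isCompact_fracIdeal K a)) fun p hp ↦ ?_
    by_cases h5 : p.1 ∈ fracIdeal K (d - b)
    · have h6 : p.2 ∉ fracIdeal K a := fun h6 ↦ hp ⟨h5, h6⟩
      simp [Function.uncurry_def, hab.supp _ h6]
    · simp [Function.uncurry_def, ball_of_notMem h5]

end Integral

/-! ### The unit filtration and invariance under it. -/

section Units

variable {K : Type*} [Field K] [ValuativeRel K] [TopologicalSpace K] [IsNonarchimedeanLocalField K]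

/-- `u` is a unit of the ring of integers, congruent to `1` modulo the ideal of level `c`. -/
structure IsUnitLevel (c : ℤ) (u : K) : Prop where
  ne_zero : u ≠ 0
  ord_eq : ord K u = 0
  sub_one_mem : u - 1 ∈ fracIdeal K c

theorem IsUnitLevel.ord_mul {c : ℤ} {u : K} (hu : IsUnitLevel c u) (x : K) :
    ord K (u * x) = ord K x := by
  by_cases hx : x = 0
  · simp [hx]
  rw [LocalStar.ord_mul hu.ne_zero hx, hu.ord_eq, zero_add]

theorem IsUnitLevel.mul_mem_iff {c : ℤ} {u : K} (hu : IsUnitLevel c u) {m : ℤ} {x : K} :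
    u * x ∈ fracIdeal K m ↔ x ∈ fracIdeal K m := by
  rw [mul_mem_fracIdeal_iff hu.ne_zero, hu.ord_eq, sub_zero]

theorem IsUnitLevel.inv {c : ℤ} {u : K} (hu : IsUnitLevel c u) : IsUnitLevel c u⁻¹ where
  ne_zero := inv_ne_zero hu.ne_zero
  ord_eq := by rw [ord_inv, hu.ord_eq, neg_zero]
  sub_one_mem := by
    rw [← hu.mul_mem_iff, mul_sub, mul_inv_cancel₀ hu.ne_zero, mul_one, ← neg_sub]
    exact neg_mem hu.sub_one_mem

theorem isUnitLevel_zero {u : K} (hu : u ≠ 0) (h : ord K u = 0) : IsUnitLevel 0 u :=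
  ⟨hu, h, sub_mem (Or.inr h.ge) (Or.inr (by simp))⟩

theorem isUnitLevel_neg_one : IsUnitLevel 0 (-1 : K) :=
  isUnitLevel_zero (by simp) (by simp)

theorem isUnitLevel_one_add {c : ℤ} (hc : 1 ≤ c) {s : K} (hs : s ∈ fracIdeal K c) :
    IsUnitLevel c (1 + s) := by
  have h1 : (1 : K) ∉ fracIdeal K c := notMem_fracIdeal.2 ⟨one_ne_zero, by rw [ord_one]; omega⟩
  obtain ⟨h2, h3⟩ := ord_add_of_notMem h1 hs
  exact ⟨(notMem_fracIdeal.1 h2).1, by simpa using h3, by simpa using hs⟩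

/-- `f` is invariant under multiplication by the units congruent to `1` at level `c`. -/
def UnitInvariant (c : ℤ) (f : K → ℂ) : Prop := ∀ u, IsUnitLevel c u → ∀ x, f (u * x) = f x

/-- On the support ideal of level `a`, multiplication by `u` is translation by `(u - 1) * x`, which
has level at least `b` once `u` is close enough to `1`. -/
theorem exists_unitInvariant {f : K → ℂ} (hf : f ∈ SchwartzBruhat K) :
    ∃ n : ℕ, UnitInvariant (n : ℤ) f := by
  obtain ⟨a, b, h⟩ := exists_hasLevel hf
  refine ⟨(b - a).toNat, fun u hu x ↦ ?_⟩
  by_cases hx : x ∈ fracIdeal K a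
  · have h1 := h.inv x ((u - 1) * x)
      (fracIdeal_anti (by omega) (mul_mem_fracIdeal hu.sub_one_mem hx))
    rw [← h1]
    congr 1
    ring
  · rw [h.supp x hx, h.supp _ (hu.mul_mem_iff.not.2 hx)]

theorem ball_unit_mul {c : ℤ} {u : K} (hu : IsUnitLevel c u) (m : ℤ) (x : K) :
    ball m (u * x) = ball m x := by
  rw [ball_mul hu.ne_zero, hu.ord_eq, sub_zero]

theorem shells_unit_mul {c : ℤ} {u : K} (hu : IsUnitLevel c u) (Q : Set ℤ) (f : K → ℂ) (x : K) :
    shells Q f (u * x) = shells Q (fun x ↦ f (u * x)) x := by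
  by_cases hx : x = 0
  · simp [hx]
  by_cases hQ : ord K x ∈ Q
  · rw [shells_of_mem hx hQ, shells_of_mem (mul_ne_zero hu.ne_zero hx) (by rwa [hu.ord_mul])]
  · rw [shells_of_notMem hQ, shells_of_notMem (by rwa [hu.ord_mul])]

theorem fold_unit_mul {c : ℤ} {u : K} (hu : IsUnitLevel c u) (π x : K) :
    fold π (u * x) = u * fold π x := by
  rw [fold, fold, hu.ord_mul, mul_left_comm]

theorem nabla_unit_mul {c : ℤ} {u : K} (hu : IsUnitLevel c u) (π x : K) :
    nabla π (u * x) = u * nabla π x := by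
  rw [nabla, nabla, hu.ord_mul, mul_left_comm]

theorem W_unit_mul {c : ℤ} {u : K} (hu : IsUnitLevel c u) (π : K) (f : K → ℂ) (x : K) :
    W π f (u * x) = W π (fun x ↦ f (u * x)) x := by
  rw [W_eq_comp_fold, W_eq_comp_fold, fold_unit_mul hu]

theorem W_add (π : K) (f g : K → ℂ) : W π (f + g) = W π f + W π g := by
  ext x; simp [W_eq_comp_fold]

theorem W_smul (π : K) (c : ℂ) (f : K → ℂ) : W π (c • f) = c • W π f := by
  ext x; simp [W_eq_comp_fold]

theorem W_ball {π : K} (hπ : ord K π = 1) (b : ℤ) : W π (ball b) = ball (2 * b) := by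
  ext x
  rw [W_eq_comp_fold]
  by_cases hx0 : x = 0
  · simp [hx0, fold, ball_of_mem, zero_mem]
  have h : fold π x ∈ fracIdeal K b ↔ x ∈ fracIdeal K (2 * b) := by
    rw [mem_fracIdeal_of_ne_zero hx0, mem_fracIdeal_of_ne_zero (fold_ne_zero hπ hx0), ord_fold hπ]
    omega
  by_cases hx : x ∈ fracIdeal K (2 * b)
  · rw [ball_of_mem hx, ball_of_mem (h.2 hx)]
  · rw [ball_of_notMem hx, ball_of_notMem (h.not.2 hx)]

theorem ball_nabla {π : K} (hπ : ord K π = 1) (m : ℤ) (x : K) :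
    ball m (nabla π x) = ball ((m + 1) / 2) x := by
  by_cases hx0 : x = 0
  · simp [hx0, nabla, ball_of_mem, zero_mem]
  have h : nabla π x ∈ fracIdeal K m ↔ x ∈ fracIdeal K ((m + 1) / 2) := by
    rw [mem_fracIdeal_of_ne_zero hx0, mem_fracIdeal_of_ne_zero (nabla_ne_zero hπ hx0),
      ord_nabla hπ]
    omega
  by_cases hx : x ∈ fracIdeal K ((m + 1) / 2)
  · rw [ball_of_mem hx, ball_of_mem (h.2 hx)]
  · rw [ball_of_notMem hx, ball_of_notMem (h.not.2 hx)]

/-- Fourier transforms of functions supported on shells of large valuation are invariant under units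
close to `1`. -/
theorem fourier_unit_mul_eq [MeasurableSpace K] (μ : Measure K) {ψ : AddChar K Circle} {d : ℤ}
    (hd : IsConductor ψ d) {c : ℤ} {u : K}
    (hu : IsUnitLevel (c - 1) u) {f : K → ℂ} {Q : Set ℤ} {y : K}
    (hQ : y = 0 ∨ ∀ n ∈ Q, d - c - ord K y < n) :
    fourier ψ μ (shells Q f) (u * y) = fourier ψ μ (shells Q f) y := by
  unfold fourier
  congr 1
  ext x
  by_cases hx : x ≠ 0 ∧ ord K x ∈ Q
  · congr 2
    -- The first summand has valuation level at least `d` on the shells in `Q`, so `ψ` does not see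
    -- it.
    have h : x * (u * y) = x * ((u - 1) * y) + x * y := by ring
    rw [h, AddChar.map_add_eq_mul, hd.eq_one, one_mul]
    rcases hQ with rfl | hQ
    · simp [zero_mem]
    · exact fracIdeal_anti (by have := hQ _ hx.2; omega)
        (mul_mem_fracIdeal (self_mem_fracIdeal x)
          (mul_mem_fracIdeal hu.sub_one_mem (self_mem_fracIdeal y)))
  · simp [shells, hx]

end Units

/-! ### The square of the `*`-transform and bijectivity. -/

section Star

variable {K : Type*} [Field K] [ValuativeRel K] [TopologicalSpace K] [IsNonarchimedeanLocalField K]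
  [MeasurableSpace K] [BorelSpace K] (μ : Measure K) [μ.IsAddHaarMeasure]
  {ψ : AddChar K Circle} {d : ℤ}

/-- Truncations of unit-invariant functions to shells of small valuation have Fourier transforms
vanishing near the origin. -/
theorem fourier_shells_eq_zero (hd : IsConductor ψ d) {c : ℤ} (hc : 1 ≤ c) {f : K → ℂ}
    (hf : UnitInvariant c f) {Q : Set ℤ} {y : K} (hy : y ≠ 0)
    (hQ : ∀ n ∈ Q, n < d - c - ord K y) : fourier ψ μ (shells Q f) y = 0 := by
  obtain ⟨t, ht, hty⟩ := hd.exists_mul_ne_one (m := d - 1 - ord K y) (y := y)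
    (notMem_fracIdeal.2 ⟨hy, by omega⟩)
  refine fourier_eq_zero_of_translation μ (fun x ↦ ?_) hty
  have hzero : ∀ z ∈ fracIdeal K (d - c - ord K y), shells Q f z = 0 := by
    rintro z (rfl | hz)
    · exact shells_zero Q f
    · exact shells_of_notMem fun h ↦ (hQ _ h).not_ge hz
  have ht' : t ∈ fracIdeal K (d - c - ord K y) := fracIdeal_anti (by omega) ht
  by_cases hx : x ∈ fracIdeal K (d - c - ord K y)
  · rw [hzero x hx, hzero _ (add_mem hx ht')]
  · obtain ⟨hx0, hx1⟩ := notMem_fracIdeal.1 hx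
    -- On these shells the additive translation by `t` is multiplication by an element of `U^c`,
    -- under which `f` is invariant.
    have hu : IsUnitLevel c (1 + x⁻¹ * t) := by
      refine isUnitLevel_one_add hc ((mul_mem_fracIdeal_iff (inv_ne_zero hx0)).2 ?_)
      rw [ord_inv]
      exact fracIdeal_anti (by omega) ht
    rw [show x + t = (1 + x⁻¹ * t) * x by field_simp, shells_unit_mul hu]
    congr 1
    ext z
    exact hf _ hu z

variable (hψ : Continuous ψ)
include hψ

theorem fourier_comp_unit_mul {c : ℤ} {u : K} (hu : IsUnitLevel c u) {f : K → ℂ}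
    (hf : f ∈ SchwartzBruhat K) (y : K) :
    fourier ψ μ (fun x ↦ f (u * x)) y = fourier ψ μ f (u⁻¹ * y) := by
  rw [fourier_comp_mul μ hψ hf hu.ne_zero, dilationFactor_of_ord_eq_zero μ hu.ord_eq, one_mul]

/-- The oscillation at level `c` of a function on shells with valuation in `Q` has its Fourier
transform concentrated on the shells with valuation in `d - c - Q`. -/
theorem fourier_shells_sub_unit_mul (hd : IsConductor ψ d) {c : ℤ} (hc : 1 ≤ c) {a b m : ℤ}
    {f : K → ℂ} (hf : HasLevel a b f) (hf0 : ∀ x ∈ fracIdeal K m, f x = 0)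
    (hfc : UnitInvariant c f) {u : K} (hu : IsUnitLevel (c - 1) u) {Q : Set ℤ} {y : K}
    (hy : y = 0 ∨ d - c - ord K y ∉ Q) :
    fourier ψ μ (shells Q (fun x ↦ f x - f (u * x))) y = 0 := by
  have hS : ∀ R : Set ℤ, shells R f ∈ SchwartzBruhat K := fun R ↦ (hasLevel_shells hf hf0 R).mem
  have hSu : ∀ R : Set ℤ, (fun x ↦ shells R f (u * x)) ∈ SchwartzBruhat K := fun R ↦
    comp_mul_mem (hS R) hu.ne_zero
  have hsub : ∀ R : Set ℤ, shells R (fun x ↦ f x - f (u * x)) =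
      shells R f - fun x ↦ shells R f (u * x) := by
    intro R
    ext x
    rw [Pi.sub_apply, shells_unit_mul hu]
    unfold shells
    split_ifs <;> simp
  -- On shells above the critical valuation the transform does not distinguish `f` from `f (u * ·)`,
  -- so the difference cancels. Below it the transform vanishes by invariance under `U^c`, and the
  -- critical shell itself is excluded by `hy`.
  have hlarge : ∀ R : Set ℤ, (y = 0 ∨ ∀ n ∈ R, d - c - ord K y < n) →
      fourier ψ μ (shells R (fun x ↦ f x - f (u * x))) y = 0 := by
    intro R hR
    rw [hsub, fourier_sub μ hψ (hS R) (hSu R), fourier_comp_unit_mul μ hψ hu (hS R),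
      fourier_unit_mul_eq μ hd hu.inv hR, sub_self]
  rcases hy with rfl | hy
  · exact hlarge Q (Or.inl rfl)
  by_cases hy0 : y = 0
  · exact hlarge Q (Or.inl hy0)
  have hsplit : shells Q (fun x ↦ f x - f (u * x)) =
      shells (Q ∩ Set.Iio (d - c - ord K y)) (fun x ↦ f x - f (u * x)) +
      shells (Q ∩ Set.Ioi (d - c - ord K y)) (fun x ↦ f x - f (u * x)) := by
    ext x
    rw [Pi.add_apply]
    by_cases hx : x = 0
    · simp [hx]
    by_cases hxQ : ord K x ∈ Q
    · rcases lt_trichotomy (ord K x) (d - c - ord K y) with h | h | h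
      · rw [shells_of_mem hx hxQ, shells_of_mem (Q := Q ∩ Set.Iio (d - c - ord K y)) hx ⟨hxQ, h⟩,
          shells_of_notMem fun h' ↦ h.not_gt h'.2, add_zero]
      · exact absurd (h ▸ hxQ) hy
      · rw [shells_of_mem hx hxQ, shells_of_mem (Q := Q ∩ Set.Ioi (d - c - ord K y)) hx ⟨hxQ, h⟩,
          shells_of_notMem fun h' ↦ h.not_gt h'.2, zero_add]
    · rw [shells_of_notMem hxQ, shells_of_notMem fun h' ↦ hxQ h'.1,
        shells_of_notMem fun h' ↦ hxQ h'.1, add_zero]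
  have hmem : ∀ R : Set ℤ, shells R (fun x ↦ f x - f (u * x)) ∈ SchwartzBruhat K := fun R ↦
    hsub R ▸ sub_mem (hS R) (hSu R)
  have hinv : UnitInvariant c (fun x ↦ f x - f (u * x)) := by
    intro v hv x
    simp only [mul_left_comm u v, hfc v hv]
  rw [hsplit, fourier_add μ hψ (hmem _) (hmem _),
    fourier_shells_eq_zero μ hd hc hinv hy0 fun n hn ↦ hn.2, hlarge _ (Or.inr fun n hn ↦ hn.2),
    add_zero]

variable {π : K} (hπ : ord K π = 1)
include hπ

theorem starTransform_add {f g : K → ℂ} (hf : f ∈ SchwartzBruhat K) (hg : g ∈ SchwartzBruhat K) :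
    starTransform π ψ μ (f + g) = starTransform π ψ μ f + starTransform π ψ μ g := by
  ext x
  simp only [starTransform, W_add, Pi.add_apply]
  exact fourier_add μ hψ (W_mem hπ hf) (W_mem hπ hg) _

theorem starTransform_unit_mul {c : ℤ} {u : K} (hu : IsUnitLevel c u) {f : K → ℂ}
    (hf : f ∈ SchwartzBruhat K) (x : K) :
    starTransform π ψ μ (fun x ↦ f (u * x)) x = starTransform π ψ μ f (u⁻¹ * x) := by
  have h : W π (fun x ↦ f (u * x)) = fun x ↦ W π f (u * x) := by
    ext x; rw [W_unit_mul hu]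
  rw [starTransform, h, fourier_comp_unit_mul μ hψ hu (W_mem hπ hf), starTransform,
    nabla_unit_mul hu.inv]

variable (hd : IsConductor ψ d)
include hd

/-- The `*`-transform as a linear endomorphism of the Schwartz-Bruhat space. -/
def starMap : SchwartzBruhat K →ₗ[ℂ] SchwartzBruhat K where
  toFun g := ⟨starTransform π ψ μ g, comp_nabla_mem hπ (fourier_mem μ hd (W_mem hπ g.2))⟩
  map_add' f g := Subtype.ext (starTransform_add μ hψ hπ f.2 g.2)
  map_smul' c f := by
    refine Subtype.ext (funext fun x ↦ ?_)
    simp only [Submodule.coe_smul, starTransform, W_smul, fourier_smul, RingHom.id_apply,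
      Pi.smul_apply, smul_eq_mul]

theorem starMap_apply (g : SchwartzBruhat K) (x : K) :
    (starMap μ hψ hπ hd g : K → ℂ) x = starTransform π ψ μ g x := rfl

/-- Dilation by a nonzero element on the Schwartz-Bruhat space. -/
def dilate {u : K} (hu : u ≠ 0) (f : SchwartzBruhat K) : SchwartzBruhat K :=
  ⟨fun x ↦ (f : K → ℂ) (u * x), comp_mul_mem f.2 hu⟩

/-- The `*`-transform turns dilation by `u` into dilation by `u⁻¹`, so its square commutes with unit
dilations. -/
theorem starMap_starMap_dilate {c : ℤ} {u : K} (hu : IsUnitLevel c u) (f : SchwartzBruhat K)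
    (x : K) : (starMap μ hψ hπ hd (starMap μ hψ hπ hd (dilate hu.ne_zero f)) : K → ℂ) x =
      (starMap μ hψ hπ hd (starMap μ hψ hπ hd f) : K → ℂ) (u * x) := by
  have h : starMap μ hψ hπ hd (dilate hu.ne_zero f) =
      dilate hu.inv.ne_zero (starMap μ hψ hπ hd f) :=
    Subtype.ext (funext fun x ↦ starTransform_unit_mul μ hψ hπ hu f.2 x)
  rw [h, starMap_apply, starMap_apply]
  have h2 := starTransform_unit_mul μ hψ hπ hu.inv (starMap μ hψ hπ hd f).2 x
  rw [inv_inv] at h2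
  exact h2

/-- The `*`-transform of the indicator function of a fractional ideal. -/
theorem starMap_ball (b : ℤ) : starMap μ hψ hπ hd ⟨ball b, ball_mem b⟩ =
    vol μ (2 * b) • ⟨ball ((d + 1) / 2 - b), ball_mem _⟩ := by
  refine Subtype.ext (funext fun x ↦ ?_)
  simp only [starMap_apply, starTransform, W_ball hπ, fourier_ball μ hd, ball_nabla hπ,
    Submodule.coe_smul, Pi.smul_apply, smul_eq_mul]
  congr 3
  omega

/-- The two volumes that arise have levels with sum independent of `b`, so the scalar is the same
for all balls. -/
theorem starMap_starMap_ball (b : ℤ) :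
    starMap μ hψ hπ hd (starMap μ hψ hπ hd ⟨ball b, ball_mem b⟩) =
    (vol μ 0 * vol μ (2 * ((d + 1) / 2))) • ⟨ball b, ball_mem b⟩ := by
  rw [starMap_ball, map_smul, starMap_ball, smul_smul, sub_sub_cancel,
    vol_mul_vol μ hπ (show 2 * b + 2 * ((d + 1) / 2 - b) = 0 + 2 * ((d + 1) / 2) by ring)]

/-- On radial functions the square of the `*`-transform is a scalar. -/
theorem starMap_starMap_of_radial (f : SchwartzBruhat K) (hf : UnitInvariant 0 (f : K → ℂ)) :
    starMap μ hψ hπ hd (starMap μ hψ hπ hd f) =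
      (vol μ 0 * vol μ (2 * ((d + 1) / 2))) • f := by
  have key : ∀ (n : ℕ) (a : ℤ) (f : SchwartzBruhat K), UnitInvariant 0 (f : K → ℂ) →
      HasLevel a (a + n) (f : K → ℂ) → starMap μ hψ hπ hd (starMap μ hψ hπ hd f) =
      (vol μ 0 * vol μ (2 * ((d + 1) / 2))) • f := by
    intro n
    induction n with
    | zero =>
      intro a f hf h
      have hfa : f = (f : K → ℂ) 0 • ⟨ball a, ball_mem a⟩ := by
        refine Subtype.ext (funext fun x ↦ ?_)
        simp only [Submodule.coe_smul, Pi.smul_apply, smul_eq_mul]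
        by_cases hx : x ∈ fracIdeal K a
        · rw [ball_of_mem hx, mul_one, h.const (by simpa using hx)]
        · rw [ball_of_notMem hx, mul_zero, h.supp x hx]
      rw [hfa, map_smul, map_smul, starMap_starMap_ball, smul_comm]
    | succ n ih =>
      intro a f hf h
      -- A radial function is constant on the shell of valuation `a`; subtracting this multiple of
      -- `ball a` removes the outermost shell.
      set s : SchwartzBruhat K := (f : K → ℂ) (π ^ a) • ⟨ball a, ball_mem a⟩ with hs
      have hs2 : starMap μ hψ hπ hd (starMap μ hψ hπ hd s) =
          (vol μ 0 * vol μ (2 * ((d + 1) / 2))) • s := by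
        rw [hs, map_smul, map_smul, starMap_starMap_ball, smul_comm]
      have hsx : ∀ x, (s : K → ℂ) x = (f : K → ℂ) (π ^ a) * ball a x := fun _ ↦ rfl
      have hg := ih (a + 1) (f - s) ?_ ?_
      · rw [map_sub, map_sub, hs2, smul_sub] at hg
        exact sub_left_injective hg
      · intro u hu x
        simp only [Submodule.coe_sub, Pi.sub_apply, hsx, hf u hu, ball_unit_mul hu]
      · constructor
        · intro x hx
          simp only [Submodule.coe_sub, Pi.sub_apply, hsx]
          by_cases hxa : x ∈ fracIdeal K a
          · obtain ⟨hx0, hx1⟩ := notMem_fracIdeal.1 hx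
            rw [mem_fracIdeal_of_ne_zero hx0] at hxa
            have hp := zpow_ne_zero (-a) (uniformizer_ne_zero hπ)
            have hu : IsUnitLevel 0 (π ^ (-a) * x) := isUnitLevel_zero (mul_ne_zero hp hx0)
              (by rw [ord_uniformizer_zpow_mul hπ _ hx0]; omega)
            have h1 := hf _ hu (π ^ a)
            rw [show π ^ (-a) * x * π ^ a = x * (π ^ (-a) * π ^ a) by ring,
              ← zpow_add₀ (uniformizer_ne_zero hπ), neg_add_cancel, zpow_zero, mul_one] at h1
            rw [h1, ball_of_mem (Or.inr hxa), mul_one, sub_self]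
          · rw [h.supp x hxa, ball_of_notMem hxa, mul_zero, sub_zero]
        · intro x t ht
          simp only [Submodule.coe_sub, Pi.sub_apply, hsx]
          rw [h.inv x t (fracIdeal_anti (by push_cast; omega) ht),
            (hasLevel_ball a).inv x t (fracIdeal_anti (by omega) ht)]
  obtain ⟨a, b, h⟩ := exists_hasLevel f.2
  exact key (b - a).toNat a f hf (h.mono le_rfl (by omega))

/-- On the oscillation at level `c` the square of the `*`-transform is, up to a reflection,
a scalar. -/
theorem exists_starMap_starMap_sub_dilate {c : ℤ} (hc : 1 ≤ c) : ∃ C : ℂ, C ≠ 0 ∧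
    ∀ f : SchwartzBruhat K, UnitInvariant c (f : K → ℂ) →
    ∀ (u : K) (hu : IsUnitLevel (c - 1) u) (x : K),
    (starMap μ hψ hπ hd (starMap μ hψ hπ hd (f - dilate hu.ne_zero f)) : K → ℂ) x =
      C * ((f - dilate hu.ne_zero f : SchwartzBruhat K) : K → ℂ) (-x) := by
  have hπ0 := uniformizer_ne_zero hπ
  have hV : vol μ 0 * vol μ d ≠ 0 := mul_ne_zero (vol_ne_zero μ 0) (vol_ne_zero μ d)
  refine ⟨if Even (d - c) then vol μ 0 * vol μ d else
    dilationFactor μ π⁻¹ * (vol μ 0 * vol μ d), ?_, ?_⟩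
  · split_ifs
    · exact hV
    · exact mul_ne_zero (dilationFactor_ne_zero μ _) hV
  intro f hf u hu
  obtain ⟨a, b, hab⟩ := exists_hasLevel f.2
  obtain ⟨φ, hφ⟩ : ∃ φ, φ = f - dilate hu.ne_zero f := ⟨_, rfl⟩
  rw [← hφ]
  have hφx : ∀ x, (φ : K → ℂ) x = (f : K → ℂ) x - (f : K → ℂ) (u * x) := by
    intro x; rw [hφ]; rfl
  have hφ0 : (φ : K → ℂ) 0 = 0 := by rw [hφx, mul_zero, sub_self]
  -- Subtracting a radial function makes `f` vanish near the origin.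
  set g : K → ℂ := (f : K → ℂ) - (f : K → ℂ) 0 • ball b with hg
  have hgx : ∀ x, g x = (f : K → ℂ) x - (f : K → ℂ) 0 * ball b x := fun _ ↦ rfl
  have hglevel : HasLevel (min a b) b g := by
    have h2 := hasLevel_ball (K := K) b
    refine ⟨fun x hx ↦ ?_, fun x t ht ↦ ?_⟩
    · rw [hgx, hab.supp x fun h ↦ hx (fracIdeal_anti (min_le_left a b) h),
        h2.supp x fun h ↦ hx (fracIdeal_anti (min_le_right a b) h), mul_zero, sub_zero]
    · rw [hgx, hgx, hab.inv x t ht, h2.inv x t ht]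
  have hg0 : ∀ x ∈ fracIdeal K b, g x = 0 := by
    intro x hx
    rw [hgx, hab.const hx, ball_of_mem hx, mul_one, sub_self]
  have hW0 : ∀ x ∈ fracIdeal K (2 * b), W π g x = 0 := by
    rintro x (rfl | hx)
    · rw [W_eq_comp_fold]
      exact hg0 _ (by simp [fold, zero_mem])
    · rw [W_eq_comp_fold]
      exact hg0 _ (Or.inr (by rw [ord_fold hπ]; omega))
  have hWc : UnitInvariant c (W π g) := by
    intro v hv x
    rw [W_unit_mul hv]
    congr 1
    ext z
    rw [hgx, hgx, hf v hv, ball_unit_mul hv]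
  set H : K → ℂ := fun x ↦ W π g x - W π g (u * x) with hH
  have hHφ : H = W π φ := by
    ext x
    simp only [hH, W_eq_comp_fold, fold_unit_mul hu, hgx, hφx, ball_unit_mul hu]
    ring
  have hWlevel := hasLevel_W hπ hglevel
  have hHmem : ∀ R : Set ℤ, shells R H ∈ SchwartzBruhat K := by
    intro R
    have h1 : HasLevel (2 * min a b) (2 * b) H :=
      ⟨fun x hx ↦ by simp only [hH]; rw [hWlevel.supp x hx,
          hWlevel.supp _ (hu.mul_mem_iff.not.2 hx), sub_zero],
        fun x t ht ↦ by simp only [hH]; rw [mul_add, hWlevel.inv x t ht,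
          hWlevel.inv _ _ (hu.mul_mem_iff.2 ht)]⟩
    exact (hasLevel_shells h1 (m := 2 * b) (fun x hx ↦ by
      simp only [hH]; rw [hW0 x hx, hW0 _ (hu.mul_mem_iff.2 hx), sub_zero]) R).mem
  have hK1 : ∀ (R : Set ℤ) (y : K), (y = 0 ∨ d - c - ord K y ∉ R) →
      fourier ψ μ (shells R H) y = 0 := fun R y hy ↦
    fourier_shells_sub_unit_mul μ hψ hd hc hWlevel hW0 hWc hu hy
  -- These are the shells whose transforms land on even valuations, the only ones that `nabla`
  -- reaches.
  set Q : Set ℤ := {n | Even (d - c - n)} with hQ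
  set F : K → ℂ := fourier ψ μ (shells Q H) with hF
  have hFmem : F ∈ SchwartzBruhat K := fourier_mem μ hd (hHmem Q)
  have hF0 : F 0 = 0 := hK1 Q 0 (Or.inl rfl)
  have hFodd : ∀ y, ¬ Even (ord K y) → F y = 0 := fun y hy ↦ hK1 Q y (Or.inr (by
    simpa [hQ] using hy))
  have hsplit : W π φ = shells Q H + shells Qᶜ H := by
    ext x
    rw [← hHφ, Pi.add_apply]
    by_cases hx : x = 0
    · simp [hx, hH]
    by_cases hxQ : ord K x ∈ Q
    · simp [shells, hx, hxQ]
    · simp [shells, hx, hxQ]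
  have hTφ : ∀ x, (starMap μ hψ hπ hd φ : K → ℂ) x = F (nabla π x) := by
    intro x
    rw [starMap_apply, starTransform, hsplit, fourier_add μ hψ (hHmem _) (hHmem _),
      hK1 Qᶜ, add_zero]
    right
    simp [hQ, ord_nabla hπ]
  -- Since `F` lives on even valuations, the two summands have disjoint supports: even valuations
  -- for the first, odd for the second.
  have hWT : W π (starMap μ hψ hπ hd φ : K → ℂ) = F + fun x ↦ F (π⁻¹ * x) := by
    ext x
    rw [W_eq_comp_fold, hTφ, Pi.add_apply]
    by_cases hx0 : x = 0
    · simp [hx0, fold, nabla, hF0]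
    by_cases hx : Even (ord K x)
    · rw [nabla_fold_of_even hπ hx, hFodd (π⁻¹ * x), add_zero]
      rw [ord_mul (inv_ne_zero hπ0) hx0, ord_inv, hπ]
      intro h
      obtain ⟨i, hi⟩ := hx
      obtain ⟨j, hj⟩ := h
      omega
    · rw [nabla_fold_of_odd hπ (Int.not_even_iff_odd.1 hx), hFodd x hx, zero_add]
  intro x
  rw [starMap_apply, starTransform, hWT,
    fourier_add μ hψ hFmem (comp_mul_mem hFmem (inv_ne_zero hπ0)),
    fourier_comp_mul μ hψ hFmem (inv_ne_zero hπ0), inv_inv, hF,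
    fourier_fourier μ hψ hd hπ (hHmem Q), fourier_fourier μ hψ hd hπ (hHmem Q)]
  have hneg : -nabla π x = nabla π (-x) := by simp [nabla]
  rw [← mul_neg, hneg]
  by_cases hx : x = 0
  · simp [hx, nabla, hφ0]
  have hx' : nabla π (-x) ≠ 0 := nabla_ne_zero hπ (neg_ne_zero.2 hx)
  have e1 : ord K (nabla π (-x)) = 2 * ord K x := by rw [ord_nabla hπ, ord_neg]
  have e2 : ord K (π * nabla π (-x)) = 1 + 2 * ord K x := by rw [ord_mul hπ0 hx', hπ, e1]
  have v1 : H (nabla π (-x)) = (φ : K → ℂ) (-x) := by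
    rw [hHφ, W_eq_comp_fold, fold_nabla hπ]
  have v2 : H (π * nabla π (-x)) = (φ : K → ℂ) (-x) := by
    rw [hHφ, W_eq_comp_fold, fold_mul_nabla hπ]
  -- Inversion leaves `shells Q H` at `nabla π (-x)` and at `π * nabla π (-x)`, of even and odd
  -- valuation. Exactly one valuation lies in `Q`, according to the parity of `d - c`, and `H` takes
  -- the value `φ (-x)` at both points.
  split_ifs with hpar
  · obtain ⟨k, hk⟩ := hpar
    rw [shells_of_mem hx' (by rw [e1]; exact ⟨k - ord K x, by omega⟩), v1, shells_of_notMem]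
    · ring
    · rw [e2]
      rintro ⟨j, hj⟩
      omega
  · obtain ⟨k, hk⟩ := Int.not_even_iff_odd.1 hpar
    rw [shells_of_mem (mul_ne_zero hπ0 hx') (by rw [e2]; exact ⟨k - ord K x, by omega⟩), v2,
      shells_of_notMem]
    · ring
    · rw [e1]
      rintro ⟨j, hj⟩
      omega

/-- The inductive step for both halves of bijectivity: modulo functions one level lower in the
filtration, the squared transform is a nonzero multiple of reflection. -/
theorem sub_dilate_identity {c : ℤ} (hc : 1 ≤ c) : ∃ C : ℂ, C ≠ 0 ∧
    ∀ f : SchwartzBruhat K, UnitInvariant c (f : K → ℂ) → UnitInvariant (c - 1) (fun x ↦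
      (starMap μ hψ hπ hd (starMap μ hψ hπ hd f) : K → ℂ) x - C * (f : K → ℂ) (-x)) := by
  obtain ⟨C, hC, h⟩ := exists_starMap_starMap_sub_dilate μ hψ hπ hd hc
  refine ⟨C, hC, fun f hf u hu x ↦ ?_⟩
  have h1 := h f hf u hu x
  rw [map_sub, map_sub, Submodule.coe_sub, Pi.sub_apply, starMap_starMap_dilate μ hψ hπ hd hu,
    Submodule.coe_sub, Pi.sub_apply] at h1
  change _ = C * ((f : K → ℂ) (-x) - (f : K → ℂ) (u * -x)) at h1
  rw [mul_neg] at h1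
  linear_combination -h1

/-- For `f` in the kernel, `sub_dilate_identity` leaves only `C * f (-x)`, so `f` itself gains
invariance until it is radial. -/
theorem starMap_injective : Function.Injective (starMap μ hψ hπ hd) := by
  have hC0 : vol μ 0 * vol μ (2 * ((d + 1) / 2)) ≠ 0 :=
    mul_ne_zero (vol_ne_zero μ _) (vol_ne_zero μ _)
  have key : ∀ (n : ℕ) (f : SchwartzBruhat K), UnitInvariant (n : ℤ) (f : K → ℂ) →
      starMap μ hψ hπ hd f = 0 → f = 0 := by
    intro n
    induction n with
    | zero =>
      intro f hf h
      have h1 := starMap_starMap_of_radial μ hψ hπ hd f hf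
      rw [h, map_zero] at h1
      exact (smul_eq_zero.1 h1.symm).resolve_left hC0
    | succ n ih =>
      intro f hf h
      refine ih f ?_ h
      obtain ⟨C, hC, hinv⟩ := sub_dilate_identity μ hψ hπ hd (c := (n + 1 : ℕ)) (by omega)
      intro u hu x
      have h1 := hinv f hf u (by simpa using hu) (-x)
      simp only [h, map_zero, Submodule.coe_zero, Pi.zero_apply, mul_neg, neg_neg, zero_sub,
        neg_inj] at h1
      exact mul_left_cancel₀ hC h1
  rw [injective_iff_map_eq_zero]
  intro f hf
  obtain ⟨n, hn⟩ := exists_unitInvariant f.2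
  exact key n f hn hf

theorem starMap_surjective : Function.Surjective (starMap μ hψ hπ hd) := by
  have hC0 : vol μ 0 * vol μ (2 * ((d + 1) / 2)) ≠ 0 :=
    mul_ne_zero (vol_ne_zero μ _) (vol_ne_zero μ _)
  have key : ∀ (n : ℕ) (f : SchwartzBruhat K), UnitInvariant (n : ℤ) (f : K → ℂ) →
      f ∈ LinearMap.range (starMap μ hψ hπ hd) := by
    intro n
    induction n with
    | zero =>
      intro f hf
      have h1 := starMap_starMap_of_radial μ hψ hπ hd f hf
      rw [← Submodule.smul_mem_iff _ hC0, ← h1]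
      exact LinearMap.mem_range_self _ _
    | succ n ih =>
      intro f hf
      obtain ⟨C, hC, hinv⟩ := sub_dilate_identity μ hψ hπ hd (c := (n + 1 : ℕ)) (by omega)
      -- Starting from the reflection of `f` undoes the sign, so `C • f` differs from an element of
      -- the range by a function of lower level.
      set r := dilate (isUnitLevel_neg_one (K := K)).ne_zero f with hr
      have hrx : ∀ x, (r : K → ℂ) x = (f : K → ℂ) (-1 * x) := fun _ ↦ rfl
      have hrc : UnitInvariant ((n + 1 : ℕ) : ℤ) (r : K → ℂ) := by
        intro v hv x
        rw [hrx, hrx, mul_left_comm, hf v hv]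
      have h1 := ih (starMap μ hψ hπ hd (starMap μ hψ hπ hd r) - C • f) ?_
      · rw [← Submodule.smul_mem_iff _ hC]
        have h2 := sub_mem (LinearMap.mem_range_self (starMap μ hψ hπ hd)
          (starMap μ hψ hπ hd r)) h1
        rwa [sub_sub_cancel] at h2
      · intro u hu x
        have h3 := hinv r hrc u (by simpa using hu) x
        simp only [hrx, neg_mul, one_mul, neg_neg] at h3
        exact h3
  intro f
  obtain ⟨n, hn⟩ := exists_unitInvariant f.2
  exact key n f hn

end Star
end LocalStar
end

theorem mainTheorem9 {K : Type*} [Field K] [ValuativeRel K] [TopologicalSpace K]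
    [IsNonarchimedeanLocalField K] [MeasurableSpace K] [BorelSpace K]
    (μ : MeasureTheory.Measure K) [μ.IsAddHaarMeasure]
    (ψ : AddChar K Circle) (hψ : Continuous ψ) (hψ1 : ψ ≠ 1)
    (π : K) (hπ : LocalStar.ord K π = 1) :
    (∀ g ∈ LocalStar.SchwartzBruhat K, MeasureTheory.Integrable (LocalStar.W π g) μ) ∧
    ∃ T : LocalStar.SchwartzBruhat K ≃ₗ[ℂ] LocalStar.SchwartzBruhat K,
      ∀ g : LocalStar.SchwartzBruhat K,
        (T g : K → ℂ) = LocalStar.starTransform π ψ μ (g : K → ℂ) := by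
  obtain ⟨d, hd⟩ := LocalStar.exists_isConductor hψ hψ1
  exact ⟨fun g hg ↦ LocalStar.integrable_of_mem μ (LocalStar.W_mem hπ hg),
    LinearEquiv.ofBijective (LocalStar.starMap μ hψ hπ hd)
      ⟨LocalStar.starMap_injective μ hψ hπ hd, LocalStar.starMap_surjective μ hψ hπ hd⟩,
    fun _ ↦ rfl⟩
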